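/- Define classes $\varPi_n$, $\varSigma_n$ ($n\ge 0$) of separable metrizable spaces recursively as follows. $\varPi_0$ consists of all compact metrizable spaces, and $\varSigma_0$ of all (separable metrizable) locally compact polyhedra, where a polyhedron is a space homeomorphic to the geometric realization of a simplicial complex with the metric topology. For $n\ge 0$, a separable metrizable space is of class $\varSigma_{n+1}$ if it is the union of countably many of its subspaces of class $\varPi_n$, and a space is of class $\varPi_{n+1}$ if it is homeomorphic to the limit of an inverse sequence $\dots\to Y_2\to Y_1\to Y_0$ of spaces of class $\varSigma_n$ and continuous maps. For a space $X$, let $\Sigma_0(X)$ be the collection of open subsets of $X$ and $\Pi_0(X)$ the collection of closed subsets of $X$; let $\Sigma_{n+1}(X)$ consist of all countable unions of sets in $\Pi_n(X)$, and $\Pi_{n+1}(X)$ of all countable intersections of sets in $\Sigma_n(X)$. A separable metrizable space $Y$ is of absolute class $\Sigma_n$ (respectively $\Pi_n$) if for every separable metrizable space $X$ and every embedding $e\colon Y\to X$ (a homeomorphism onto its image), the set $e(Y)$ belongs to $\Sigma_n(X)$ (respectively $\Pi_n(X)$). **Proposition.** For every $n\ge 0$, a topological space is of class $\varPi_n$ if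 and only if it is of absolute class $\Pi_n$. For every $n\ge 1$, a topological space is of class $\varSigma_n$ if and only if it is of absolute class $\Sigma_n$. -/

import Mathlib

universe u

namespace DescriptiveTopology

/-- A class of topological spaces. -/
abbrev SpaceClass : Type (u + 1) := (X : Type u) → [TopologicalSpace X] → Prop

/-- Separable metrizable spaces. -/
def IsSepMetrizable : SpaceClass.{u} := fun X _ =>
  TopologicalSpace.MetrizableSpace X ∧ TopologicalSpace.SeparableSpace X

/-! ### Polyhedra -/

/-- The geometric realization `|K|` of an abstract simplicial complex `K` with vertices in `V`: all
families `x : V → ℝ` of barycentric coordinates, that is, nonnegative, vanishing outside some simplex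
`s` of `K`, and of sum `1`. As a subset of `ℓ¹(V)`, it carries the metric topology, given by
`d x y = ∑ v, |x v - y v|`. -/
def geometricRealization {V : Type u} (K : PreAbstractSimplicialComplex V) :
    Set (lp (fun _ : V => ℝ) 1) :=
  {x | (∀ v, 0 ≤ x v) ∧ ∃ s ∈ K.faces, (∀ v, v ∉ s → x v = 0) ∧ ∑ v ∈ s, x v = 1}

/-- Polyhedra: spaces homeomorphic to a simplicial complex with the metric topology. -/
def IsPolyhedron : SpaceClass.{u} := fun X _ =>
  ∃ (V : Type u) (K : PreAbstractSimplicialComplex V), Nonempty (X ≃ₜ geometricRealization K)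

/-! ### The classes generated by inverse sequences and countable unions -/

/-- Compact metrizable spaces (these are automatically separable). -/
def IsCompactum : SpaceClass.{u} := fun X _ =>
  CompactSpace X ∧ TopologicalSpace.MetrizableSpace X

/-- Locally compact (separable metrizable) polyhedra. -/
def IsLocallyCompactPolyhedron : SpaceClass.{u} := fun X _ =>
  IsSepMetrizable X ∧ LocallyCompactSpace X ∧ IsPolyhedron X

/-- Separable metrizable spaces that are unions of countably many subspaces of class `P`. -/
def CountableUnionOf (P : SpaceClass.{u}) : SpaceClass.{u} := fun X _ =>
  IsSepMetrizable X ∧ ∃ S : ℕ → Set X, (∀ i, P (S i)) ∧ ⋃ i, S i = Set.univ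

/-- The limit of the inverse sequence `⋯ → Y 2 → Y 1 → Y 0`, topologized as a subspace of the
product. -/
def inverseLimit {Y : ℕ → Type u} (f : ∀ i, Y (i + 1) → Y i) : Set (∀ i, Y i) :=
  {y | ∀ i, f i (y (i + 1)) = y i}

/-- Limits of inverse sequences of spaces of class `P` and continuous maps. (If all spaces of class
`P` are separable metrizable, then so are their sequential inverse limits.) -/
def InverseLimitOf (P : SpaceClass.{u}) : SpaceClass.{u} := fun X _ =>
  ∃ (Y : ℕ → Type u) (_ : ∀ i, TopologicalSpace (Y i)) (f : ∀ i, Y (i + 1) → Y i),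
    (∀ i, P (Y i)) ∧ (∀ i, Continuous (f i)) ∧ Nonempty (X ≃ₜ inverseLimit f)

/-- Simultaneous recursion for the pair `(varPi n, varSigma n)`. -/
def varClass : ℕ → SpaceClass.{u} × SpaceClass.{u}
  | 0 => (IsCompactum, IsLocallyCompactPolyhedron)
  | n + 1 => (InverseLimitOf (varClass n).2, CountableUnionOf (varClass n).1)

/-- The class `ϖΠ_n`: compacta for `n = 0`, limits of inverse sequences of spaces of class
`varSigma n` for `n + 1`. -/
def varPi (n : ℕ) : SpaceClass.{u} := (varClass n).1

/-- The class `ϖΣ_n`: locally compact polyhedra for `n = 0`, countable unions of subspaces of class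
`varPi n` for `n + 1`. -/
def varSigma (n : ℕ) : SpaceClass.{u} := (varClass n).2

/-! ### Borel classes and absolute Borel classes -/

/-- Simultaneous recursion for the multiplicative and additive Borel classes
`(Π_n(X), Σ_n(X))` of subsets of `X`. -/
def borelClass (X : Type u) [TopologicalSpace X] : ℕ → Set (Set X) × Set (Set X)
  | 0 => ({s | IsClosed s}, {s | IsOpen s})
  | n + 1 =>
    ({s | ∃ t : ℕ → Set X, (∀ i, t i ∈ (borelClass X n).2) ∧ s = ⋂ i, t i},
     {s | ∃ t : ℕ → Set X, (∀ i, t i ∈ (borelClass X n).1) ∧ s = ⋃ i, t i})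

/-- `Π_0(X)`: closed sets; `Π_{n+1}(X)`: countable intersections of sets in `Σ_n(X)`. -/
def borelPi (n : ℕ) (X : Type u) [TopologicalSpace X] : Set (Set X) := (borelClass X n).1

/-- `Σ_0(X)`: open sets; `Σ_{n+1}(X)`: countable unions of sets in `Π_n(X)`. -/
def borelSigma (n : ℕ) (X : Type u) [TopologicalSpace X] : Set (Set X) := (borelClass X n).2

/-- Absolute class `Π_n`: separable metrizable spaces each of whose homeomorphic images in each
separable metrizable space `X` is in `Π_n(X)`. -/
def AbsolutePi (n : ℕ) : SpaceClass.{u} := fun Y _ =>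
  IsSepMetrizable Y ∧ ∀ (X : Type u) [TopologicalSpace X], IsSepMetrizable X →
    ∀ e : Y → X, Topology.IsEmbedding e → Set.range e ∈ borelPi n X

/-- Absolute class `Σ_n`: separable metrizable spaces each of whose homeomorphic images in each
separable metrizable space `X` is in `Σ_n(X)`. -/
def AbsoluteSigma (n : ℕ) : SpaceClass.{u} := fun Y _ =>
  IsSepMetrizable Y ∧ ∀ (X : Type u) [TopologicalSpace X], IsSepMetrizable X →
    ∀ e : Y → X, Topology.IsEmbedding e → Set.range e ∈ borelSigma n X

end DescriptiveTopology

/-! Every separable metrizable space embeds in the Hilbert cube `H`, so both directions reduce to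
Borel subsets of `H`; the induction goes two levels at a time, because `varPi (n + 2)` is built from
`varPi n` by countable unions and inverse limits.

From Borel to inductive (`varPi_of_borelPi`): a `Π_{n+2}` set is a decreasing intersection of
`Σ_{n+1}` sets, that is, an inverse limit of inclusions between countable unions of `Π_n` sets. The
geometric case is `Π_1`. Reciprocal distances to the complements turn a `G_δ` set into a closed
subset of `H × ℝ^ℕ`, hence of `ℝ^ℕ`. A closed subset of `ℝ^ℕ` is the inverse limit of its
neighbourhoods made of cubes of side `2⁻ⁿ` in `ℝⁿ`, and each of these is a locally compact
polyhedron by Freudenthal's triangulation. There the barycentric coordinate of `y` at an integer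
vertex `v` is the probability that rounding up `y - t` gives `v`, for `t` uniform in `[0, 1)`.

From inductive to absolute (`absolutePi_of_varPi`): an inverse limit is closed in the product of its
terms, and these embed in `H` as `Π_{n+1}` sets, so the limit becomes a `Π_{n+1}` subset of `H^ℕ`.
By a Lavrentiev-type argument (`range_mem_borelPi_succ`), being `Π_{n+1}` in one completely
metrizable space implies it in every metrizable one. The additive classes follow by taking unions.
-/

namespace DescriptiveTopology

open Set Filter Topology TopologicalSpace MeasureTheory

/-! ### Borel classes: intersections, inclusions, preimages -/

section Borel

variable {X Y : Type u} [TopologicalSpace X] [TopologicalSpace Y]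

theorem borelSigma_subset_borelPi_succ (n : ℕ) : borelSigma n X ⊆ borelPi (n + 1) X :=
  fun s hs => ⟨fun _ => s, fun _ => hs, (iInter_const s).symm⟩

theorem borelClass_inter (n : ℕ) :
    (∀ s ∈ borelPi n X, ∀ t ∈ borelPi n X, s ∩ t ∈ borelPi n X) ∧
    (∀ s ∈ borelSigma n X, ∀ t ∈ borelSigma n X, s ∩ t ∈ borelSigma n X) := by
  induction n with
  | zero => exact ⟨fun s hs t ht => IsClosed.inter hs ht, fun s hs t ht => IsOpen.inter hs ht⟩
  | succ n ih =>
    constructor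
    · rintro _ ⟨s, hs, rfl⟩ _ ⟨t, ht, rfl⟩
      exact ⟨fun i => s i ∩ t i, fun i => ih.2 _ (hs i) _ (ht i), (iInter_inter_distrib s t).symm⟩
    · rintro _ ⟨s, hs, rfl⟩ _ ⟨t, ht, rfl⟩
      refine ⟨fun i => s i.unpair.1 ∩ t i.unpair.2, fun i => ih.1 _ (hs _) _ (ht _), ?_⟩
      rw [iUnion_inter_iUnion, Set.iUnion_unpair (fun i j => s i ∩ t j)]

theorem borelPi_inter {n : ℕ} {s t : Set X} (hs : s ∈ borelPi n X) (ht : t ∈ borelPi n X) :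
    s ∩ t ∈ borelPi n X := (borelClass_inter n).1 s hs t ht

theorem borelSigma_inter {n : ℕ} {s t : Set X} (hs : s ∈ borelSigma n X)
    (ht : t ∈ borelSigma n X) : s ∩ t ∈ borelSigma n X := (borelClass_inter n).2 s hs t ht

theorem borelPi_succ_iInter {n : ℕ} {s : ℕ → Set X} (hs : ∀ i, s i ∈ borelPi (n + 1) X) :
    ⋂ i, s i ∈ borelPi (n + 1) X := by
  choose t ht hst using hs
  refine ⟨fun i => t i.unpair.1 i.unpair.2, fun i => ht _ _, ?_⟩
  rw [Set.iInter_unpair t]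
  exact iInter_congr hst

theorem borelClass_subset_succ [MetrizableSpace X] (n : ℕ) :
    borelPi n X ⊆ borelPi (n + 1) X ∧ borelSigma n X ⊆ borelSigma (n + 1) X := by
  induction n with
  | zero =>
    let := metrizableSpaceMetric X
    constructor
    · intro s hs
      obtain ⟨f, hf, h⟩ := isGδ_iff_eq_iInter_nat.1 (IsClosed.isGδ (show IsClosed s from hs))
      exact ⟨f, hf, h⟩
    · intro s hs
      obtain ⟨f, hf, h⟩ := isGδ_iff_eq_iInter_nat.1
        (IsClosed.isGδ (IsOpen.isClosed_compl (show IsOpen s from hs)))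
      refine ⟨fun i => (f i)ᶜ, fun i => (hf i).isClosed_compl, ?_⟩
      rw [← compl_iInter, ← h, compl_compl]
  | succ n ih =>
    constructor
    · rintro _ ⟨s, hs, rfl⟩
      exact ⟨s, fun i => ih.2 (hs i), rfl⟩
    · rintro _ ⟨s, hs, rfl⟩
      exact ⟨s, fun i => ih.1 (hs i), rfl⟩

theorem borelPi_mono [MetrizableSpace X] {m n : ℕ} (h : m ≤ n) : borelPi m X ⊆ borelPi n X := by
  induction n, h using Nat.le_induction with
  | base => exact Subset.rfl
  | succ n _ ih => exact ih.trans (borelClass_subset_succ n).1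

theorem isGδ_mem_borelPi_succ [MetrizableSpace X] {s : Set X} (hs : IsGδ s) (n : ℕ) :
    s ∈ borelPi (n + 1) X := by
  obtain ⟨f, hf, h⟩ := isGδ_iff_eq_iInter_nat.1 hs
  exact borelPi_mono (Nat.le_add_left 1 n) (show s ∈ borelPi 1 X from ⟨f, hf, h⟩)

/-- Traces on `G` are compared because the extensions to which this is applied are continuous only
on a `G_δ` set. -/
theorem exists_borelClass_inter_eq_preimage {f : X → Y} {G : Set X} (hf : ContinuousOn f G)
    (n : ℕ) :
    (∀ t ∈ borelPi n Y, ∃ s ∈ borelPi n X, f ⁻¹' t ∩ G = s ∩ G) ∧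
    (∀ t ∈ borelSigma n Y, ∃ s ∈ borelSigma n X, f ⁻¹' t ∩ G = s ∩ G) := by
  induction n with
  | zero =>
    exact ⟨fun t ht => continuousOn_iff_isClosed.1 hf t ht, fun t ht => continuousOn_iff'.1 hf t ht⟩
  | succ n ih =>
    constructor
    · rintro _ ⟨t, ht, rfl⟩
      choose s hs h using fun i => ih.2 (t i) (ht i)
      refine ⟨⋂ i, s i, ⟨s, hs, rfl⟩, ?_⟩
      rw [preimage_iInter, iInter_inter, iInter_inter]
      exact iInter_congr h
    · rintro _ ⟨t, ht, rfl⟩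
      choose s hs h using fun i => ih.1 (t i) (ht i)
      refine ⟨⋃ i, s i, ⟨s, hs, rfl⟩, ?_⟩
      rw [preimage_iUnion, iUnion_inter, iUnion_inter]
      exact iUnion_congr h

theorem borelPi_preimage {f : X → Y} (hf : Continuous f) {n : ℕ} {t : Set Y}
    (ht : t ∈ borelPi n Y) : f ⁻¹' t ∈ borelPi n X := by
  obtain ⟨s, hs, h⟩ := (exists_borelClass_inter_eq_preimage (hf.continuousOn (s := univ)) n).1 t ht
  rw [inter_univ, inter_univ] at h
  rwa [h]

end Borel

/-! ### Extension over `G_δ` sets and independence of the ambient space -/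

/-- A continuous map from a subspace to a completely metrizable space extends continuously over a
`G_δ` set. -/
theorem exists_continuousOn_extension {A Z W : Type*} [TopologicalSpace A] [TopologicalSpace Z]
    [MetrizableSpace Z] [TopologicalSpace W] [IsCompletelyMetrizableSpace W] [Nonempty W]
    {e : A → Z} (he : IsEmbedding e) {f : A → W} (hf : Continuous f) :
    ∃ (G : Set Z) (F : Z → W), IsGδ G ∧ range e ⊆ G ∧ G ⊆ closure (range e) ∧
      ContinuousOn F G ∧ ∀ a, F (e a) = f a := by
  classical
  let := metrizableSpaceMetric Z
  let := upgradeIsCompletelyMetrizable W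
  let f' : Z → W := Function.extend e f fun _ => Classical.arbitrary W
  have hf' : ∀ a, f' (e a) = f a := fun a => he.injective.extend_apply _ _ _
  -- The points near which `f`, carried over to `range e`, oscillates by less than `1 / (n + 1)`. On
  -- the intersection of all `O n` the values of `f'` along `range e` are Cauchy.
  let O : ℕ → Set Z := fun n =>
    ⋃₀ {U | IsOpen U ∧ ∀ a b, e a ∈ U → e b ∈ U → dist (f a) (f b) < 1 / ((n : ℝ) + 1)}
  have hO : ∀ n, IsOpen (O n) := fun n => isOpen_sUnion fun U hU => hU.1
  have hlim : ∀ z ∈ closure (range e) ∩ ⋂ n, O n, ∃ y, Tendsto f' (𝓝[range e] z) (𝓝 y) := by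
    rintro z ⟨hz, hzO⟩
    have : (𝓝[range e] z).NeBot := mem_closure_iff_nhdsWithin_neBot.1 hz
    have hc : Cauchy (map f' (𝓝[range e] z)) := by
      refine Metric.cauchy_iff.2 ⟨inferInstance, fun ε hε => ?_⟩
      obtain ⟨n, hn⟩ := exists_nat_one_div_lt hε
      obtain ⟨U, ⟨hU, hd⟩, hzU⟩ := mem_iInter.1 hzO n
      refine ⟨f' '' (U ∩ range e), image_mem_map ?_, ?_⟩
      · exact inter_comm U _ ▸ inter_mem self_mem_nhdsWithin
          (mem_nhdsWithin_of_mem_nhds (hU.mem_nhds hzU))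
      · rintro _ ⟨_, ⟨ha, a, rfl⟩, rfl⟩ _ ⟨_, ⟨hb, b, rfl⟩, rfl⟩
        rw [hf', hf']
        exact (hd a b ha hb).trans hn
    exact CompleteSpace.complete hc
  have hcont : ContinuousOn f' (range e) := by
    rintro _ ⟨a, rfl⟩
    rw [ContinuousWithinAt, ← he.map_nhds_eq a, tendsto_map'_iff, hf']
    exact (hf.tendsto a).congr fun b => (hf' b).symm
  refine ⟨closure (range e) ∩ ⋂ n, O n, extendFrom (range e) f',
    isClosed_closure.isGδ.inter (IsGδ.iInter_of_isOpen hO), ?_, inter_subset_left,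
    continuousOn_extendFrom inter_subset_left hlim, fun a => ?_⟩
  · rintro _ ⟨a, rfl⟩
    refine ⟨subset_closure (mem_range_self a), mem_iInter.2 fun n => ?_⟩
    have hε : (0 : ℝ) < 1 / ((n : ℝ) + 1) / 2 := by positivity
    have hm : f ⁻¹' Metric.ball (f a) (1 / ((n : ℝ) + 1) / 2) ∈ 𝓝 a :=
      hf.continuousAt (Metric.ball_mem_nhds _ hε)
    rw [he.nhds_eq_comap, mem_comap] at hm
    obtain ⟨V, hV, hVf⟩ := hm
    obtain ⟨U, hUV, hU, haU⟩ := mem_nhds_iff.1 hV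
    refine mem_sUnion.2 ⟨U, ⟨hU, fun b c hb hc => ?_⟩, haU⟩
    have h1 : dist (f b) (f a) < _ := hVf (show b ∈ e ⁻¹' V from hUV hb)
    have h2 : dist (f c) (f a) < _ := hVf (show c ∈ e ⁻¹' V from hUV hc)
    linarith [dist_triangle_right (f b) (f c) (f a)]
  · rw [extendFrom_extends hcont _ (mem_range_self a), hf']

/-- Extend `j` to `F` on a `G_δ` set `G` inside the closure of `range e`. If `F z = j a`, then `j b`
tends to `j a` as `e b` tends to `z`; hence `b` tends to `a`, and `z = e a`. So `range e` is the
preimage of `range j` within `G`. Level `n + 1` is what absorbs the `G_δ` set `G`. -/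
theorem range_mem_borelPi_succ {A Z W : Type u} [TopologicalSpace A] [TopologicalSpace Z]
    [MetrizableSpace Z] [TopologicalSpace W] [IsCompletelyMetrizableSpace W]
    {e : A → Z} (he : IsEmbedding e) {j : A → W} (hj : IsEmbedding j) {n : ℕ}
    (h : range j ∈ borelPi (n + 1) W) : range e ∈ borelPi (n + 1) Z := by
  cases isEmpty_or_nonempty A with
  | inl _ =>
    rw [range_eq_empty]
    exact isGδ_mem_borelPi_succ IsGδ.empty n
  | inr hA =>
  have : Nonempty W := hA.map j
  obtain ⟨G, F, hG, heG, hGe, hF, hFe⟩ := exists_continuousOn_extension he hj.continuous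
  obtain ⟨s, hs, hsG⟩ := (exists_borelClass_inter_eq_preimage hF (n + 1)).1 _ h
  have : range e = F ⁻¹' range j ∩ G := by
    apply Subset.antisymm
    · rintro _ ⟨a, rfl⟩
      exact ⟨⟨a, (hFe a).symm⟩, heG (mem_range_self a)⟩
    · rintro z ⟨⟨a, ha⟩, hz⟩
      have hne : (comap e (𝓝 z)).NeBot := by
        refine comap_neBot_iff.2 fun t ht => ?_
        obtain ⟨_, ht, a, rfl⟩ := mem_closure_iff_nhds.1 (hGe hz) t ht
        exact ⟨a, ht⟩
      have h1 : Tendsto (F ∘ e) (comap e (𝓝 z)) (𝓝 (F z)) := by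
        refine (hF z hz).tendsto.comp (tendsto_nhdsWithin_iff.2 ⟨tendsto_comap, ?_⟩)
        exact Eventually.of_forall fun b => heG (mem_range_self b)
      have h2 : comap e (𝓝 z) ≤ 𝓝 a := by
        rw [hj.nhds_eq_comap, ← tendsto_iff_comap, ha]
        exact h1.congr hFe
      have h3 : Tendsto e (comap e (𝓝 z)) (𝓝 (e a)) := (he.continuous.tendsto a).mono_left h2
      exact ⟨a, tendsto_nhds_unique h3 tendsto_comap⟩
  rw [this, hsG]
  exact borelPi_inter hs (isGδ_mem_borelPi_succ hG n)

/-! ### Geometric realizations and Freudenthal's triangulation of unions of cubes -/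

/-- The topology of a geometric realization is the topology of convergence of barycentric
coordinates. -/
theorem continuous_geometricRealization_iff {V : Type u} {K : PreAbstractSimplicialComplex V}
    {T : Type*} [TopologicalSpace T] {g : T → geometricRealization K} :
    Continuous g ↔ ∀ v, Continuous fun t => (g t).1 v := by
  classical
  constructor
  · intro hg v
    exact (lp.evalCLM ℝ (fun _ : V => ℝ) 1 v).continuous.comp (continuous_subtype_val.comp hg)
  · intro hg
    refine continuous_iff_continuousAt.2 fun t₀ => tendsto_iff_dist_tendsto_zero.2 ?_
    obtain ⟨h0, s, -, hs, hs1⟩ := (g t₀).2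
    -- Since both total masses are `1`, the mass of `g t` outside the simplex `s` of `g t₀` is `1`
    -- minus its mass on `s`, a finite sum of coordinates.
    have key : ∀ t, dist (g t) (g t₀) ≤
        ∑ v ∈ s, |(g t).1 v - (g t₀).1 v| + (1 - ∑ v ∈ s, (g t).1 v) := by
      intro t
      obtain ⟨h0', s', -, hs', hs1'⟩ := (g t).2
      have h1 : dist (g t) (g t₀) = ∑ v ∈ s ∪ s', |(g t).1 v - (g t₀).1 v| := by
        rw [Subtype.dist_eq, dist_eq_norm, lp.norm_eq_tsum_rpow (by simp)]
        simp only [ENNReal.toReal_one, Real.rpow_one, div_one, Real.norm_eq_abs]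
        rw [tsum_eq_sum (s := s ∪ s')]
        · rfl
        · intro v hv
          rw [Finset.mem_union, not_or] at hv
          simp [hs v hv.1, hs' v hv.2]
      have h2 : ∑ v ∈ s ∪ s', (g t).1 v = 1 := by
        rw [← hs1']
        exact (Finset.sum_subset Finset.subset_union_right fun v _ hv => hs' v hv).symm
      rw [h1, ← h2, ← Finset.sum_sdiff (Finset.subset_union_left (s₁ := s) (s₂ := s')),
        ← Finset.sum_sdiff (Finset.subset_union_left (s₁ := s) (s₂ := s')) (f := (g t).1),
        add_sub_cancel_right, add_comm]
      gcongr with v hv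
      rw [hs v (Finset.mem_sdiff.1 hv).2, sub_zero, abs_of_nonneg (h0' v)]
    have hlim : Tendsto (fun t => ∑ v ∈ s, |(g t).1 v - (g t₀).1 v| + (1 - ∑ v ∈ s, (g t).1 v))
        (𝓝 t₀) (𝓝 0) := by
      have : Continuous fun t => ∑ v ∈ s, |(g t).1 v - (g t₀).1 v| + (1 - ∑ v ∈ s, (g t).1 v) := by
        fun_prop
      have h := this.tendsto t₀
      simpa [hs1] using h
    exact squeeze_zero (fun _ => dist_nonneg) key hlim

section Cubes

variable {ι : Type}

/-- The union of the unit cubes with integer vertices whose lowest corners are in `C`. -/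
def cubeUnion (C : Set (ι → ℤ)) : Set (ι → ℝ) :=
  {y | ∃ c ∈ C, ∀ i, (c i : ℝ) ≤ y i ∧ y i ≤ c i + 1}

/-- The Freudenthal triangulation of a union of unit cubes. -/
def cubeComplex (C : Set (ι → ℤ)) : PreAbstractSimplicialComplex (ULift.{u} (ι → ℤ)) where
  faces := {s | s.Nonempty ∧ (∀ v ∈ s, ∀ w ∈ s, v.down ≤ w.down ∨ w.down ≤ v.down) ∧
    ∃ c ∈ C, ∀ v ∈ s, c ≤ v.down ∧ v.down ≤ c + 1}
  isRelLowerSet_faces := by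
    rintro s ⟨hs, hc, c, hC, h⟩
    exact ⟨hs, fun t ht hne => ⟨hne, fun v hv w hw => hc v (ht hv) w (ht hw),
      c, hC, fun v hv => h v (ht hv)⟩⟩

/-- The parameters `t ∈ [0, 1)` for which rounding up `y - t` yields `v`. -/
def roundingSet (y : ι → ℝ) (v : ι → ℤ) : Set ℝ :=
  {t | t ∈ Ico (0 : ℝ) 1 ∧ ∀ i, ⌈y i - t⌉ = v i}

/-- The barycentric coordinates of `y` in the Freudenthal triangulation. -/
noncomputable def cubeWeight (y : ι → ℝ) (v : ι → ℤ) : ℝ := volume.real (roundingSet y v)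

theorem cubeWeight_nonneg (y : ι → ℝ) (v : ι → ℤ) : 0 ≤ cubeWeight y v := measureReal_nonneg

theorem exists_of_cubeWeight_ne_zero {y : ι → ℝ} {v : ι → ℤ} (h : cubeWeight y v ≠ 0) :
    ∃ t ∈ Ico (0 : ℝ) 1, ∀ i, ⌈y i - t⌉ = v i := by
  by_contra hn
  apply h
  have : roundingSet y v = ∅ := eq_empty_of_forall_notMem fun t ht => hn ⟨t, ht.1, ht.2⟩
  rw [cubeWeight, this, measureReal_empty]

variable [Fintype ι]

/-- The entry `none` carries the constraint `0 ≤ t < 1`. As an interval whose endpoints are finite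
suprema and infima, the set has length continuous in `y`. -/
theorem roundingSet_eq_Ico (y : ι → ℝ) (v : ι → ℤ) :
    roundingSet y v = Ico
      (Finset.univ.sup' Finset.univ_nonempty fun o : Option ι => o.elim (0 : ℝ) fun i => y i - v i)
      (Finset.univ.inf' Finset.univ_nonempty
        fun o : Option ι => o.elim (1 : ℝ) fun i => y i - v i + 1) := by
  ext t
  simp only [roundingSet, mem_ofPred_eq, mem_Ico, Finset.sup'_le_iff, Finset.lt_inf'_iff,
    Finset.mem_univ, true_imp_iff, Option.forall, Option.elim, Int.ceil_eq_iff]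
  constructor
  · rintro ⟨⟨h0, h1⟩, h⟩
    exact ⟨⟨h0, fun i => by linarith [(h i).2]⟩, h1, fun i => by linarith [(h i).1]⟩
  · rintro ⟨⟨h0, h⟩, h1, h'⟩
    exact ⟨⟨h0, h1⟩, fun i => ⟨by linarith [h' i], by linarith [h i]⟩⟩

theorem continuous_cubeWeight (v : ι → ℤ) : Continuous fun y : ι → ℝ => cubeWeight y v := by
  simp only [cubeWeight, roundingSet_eq_Ico, Real.volume_real_Ico]
  refine ((Continuous.finset_inf'_apply _ ?_).sub (Continuous.finset_sup'_apply _ ?_)).max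
    continuous_const
  · rintro (_ | i) - <;> simp only [Option.elim] <;> fun_prop
  · rintro (_ | i) - <;> simp only [Option.elim] <;> fun_prop

theorem measurableSet_roundingSet (y : ι → ℝ) (v : ι → ℤ) : MeasurableSet (roundingSet y v) := by
  rw [roundingSet_eq_Ico]
  exact measurableSet_Ico

theorem volume_roundingSet_ne_top (y : ι → ℝ) (v : ι → ℤ) : volume (roundingSet y v) ≠ ⊤ := by
  rw [roundingSet_eq_Ico]
  exact measure_Ico_lt_top.ne

/-- Lay the weights of the chain end to end on `[0, 1)`, largest vertex first. The vertex `v`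
occupies `[l, u)`, and for `t` there the point minus `t` rounds up to `v`, because coordinates of
vertices of one cube differ by at most `1`. -/
theorem le_cubeWeight {s : Finset (ι → ℤ)} {x : (ι → ℤ) → ℝ} (hx : ∀ v, 0 ≤ x v)
    (hs1 : ∑ v ∈ s, x v = 1) (hs : ∀ v ∈ s, ∀ w ∈ s, v ≤ w ∨ w ≤ v) {c : ι → ℤ}
    (hc : ∀ v ∈ s, c ≤ v ∧ v ≤ c + 1) {v : ι → ℤ} (hv : v ∈ s) :
    x v ≤ cubeWeight (fun i => ∑ w ∈ s, x w * w i) v := by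
  classical
  set l := ∑ w ∈ s with v < w, x w
  set u := ∑ w ∈ s with v ≤ w, x w
  have hul : u = l + x v := by
    have : s.filter (v ≤ ·) = insert v (s.filter (v < ·)) := by
      ext w
      simp only [Finset.mem_filter, Finset.mem_insert]
      constructor
      · rintro ⟨hw, h⟩
        rcases h.eq_or_lt with h | h
        · exact Or.inl h.symm
        · exact Or.inr ⟨hw, h⟩
      · rintro (rfl | ⟨hw, h⟩)
        · exact ⟨hv, le_rfl⟩
        · exact ⟨hw, h.le⟩
    rw [show u = ∑ w ∈ s.filter (v ≤ ·), x w from rfl, this, Finset.sum_insert (by simp), add_comm]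
  have hsub : Ico l u ⊆ roundingSet (fun i => ∑ w ∈ s, x w * w i) v := by
    rintro t ⟨hlt, htu⟩
    refine ⟨⟨(Finset.sum_nonneg fun w _ => hx w).trans hlt, htu.trans_le ?_⟩, fun i => ?_⟩
    · rw [← hs1]
      exact Finset.sum_le_sum_of_subset_of_nonneg (Finset.filter_subset _ _) fun w _ _ => hx w
    have hd : ∑ w ∈ s, x w * w i - v i = ∑ w ∈ s, x w * (w i - v i) := by
      simp only [mul_sub, Finset.sum_sub_distrib, ← Finset.sum_mul, hs1, one_mul]
    have hd' : ∑ w ∈ s, x w * w i - v i + 1 = ∑ w ∈ s, x w * (w i - v i + 1) := by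
      simp only [mul_add, mul_one, Finset.sum_add_distrib, hs1, hd]
    have hle : ∀ w ∈ s, w i ≤ v i + 1 ∧ v i ≤ w i + 1 := by
      intro w hw
      have h1 : c i ≤ w i := (hc w hw).1 i
      have h2 : w i ≤ c i + 1 := (hc w hw).2 i
      have h3 : c i ≤ v i := (hc v hv).1 i
      have h4 : v i ≤ c i + 1 := (hc v hv).2 i
      omega
    have h1 : ∑ w ∈ s, x w * (w i - v i) ≤ l := by
      rw [show l = ∑ w ∈ s.filter (v < ·), x w from rfl, Finset.sum_filter]
      refine Finset.sum_le_sum fun w hw => ?_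
      split_ifs with h
      · refine mul_le_of_le_one_right (hx w) ?_
        have : (w i : ℝ) ≤ v i + 1 := by exact_mod_cast (hle w hw).1
        linarith
      · refine mul_nonpos_of_nonneg_of_nonpos (hx w) ?_
        have hwv : w ≤ v := by
          rcases hs v hv w hw with h' | h'
          · exact (eq_of_le_of_not_lt h' h).ge
          · exact h'
        have : (w i : ℝ) ≤ v i := by exact_mod_cast hwv i
        linarith
    have h2 : u ≤ ∑ w ∈ s, x w * (w i - v i + 1) := by
      rw [show u = ∑ w ∈ s.filter (v ≤ ·), x w from rfl, Finset.sum_filter]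
      refine Finset.sum_le_sum fun w hw => ?_
      split_ifs with h
      · refine le_mul_of_one_le_right (hx w) ?_
        have : (v i : ℝ) ≤ w i := by exact_mod_cast h i
        linarith
      · refine mul_nonneg (hx w) ?_
        have : (v i : ℝ) ≤ w i + 1 := by exact_mod_cast (hle w hw).2
        linarith
    rw [Int.ceil_eq_iff]
    constructor <;> linarith
  calc x v = u - l := by rw [hul]; ring
    _ = volume.real (Ico l u) := by
      rw [Real.volume_real_Ico_of_le (by linarith [hx v])]
    _ ≤ _ := measureReal_mono hsub (volume_roundingSet_ne_top _ v)

variable [DecidableEq ι]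

/-- A finite set of vertices that contains the vertices of the simplex around `y`. -/
noncomputable def cubeVertices (y : ι → ℝ) : Finset (ι → ℤ) :=
  Finset.Icc (fun i => ⌈y i⌉ - 1) (fun i => ⌈y i⌉)

theorem ceil_sub_mem_cubeVertices (y : ι → ℝ) {t : ℝ} (ht : t ∈ Ico (0 : ℝ) 1) :
    (fun i => ⌈y i - t⌉) ∈ cubeVertices y := by
  rw [cubeVertices, Finset.mem_Icc]
  refine ⟨fun i => ?_, fun i => Int.ceil_mono (by linarith [ht.1])⟩
  simp only [← Int.ceil_sub_one]
  exact Int.ceil_mono (by linarith [ht.2])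

theorem cubeWeight_eq_zero {y : ι → ℝ} {v : ι → ℤ} (h : v ∉ cubeVertices y) :
    cubeWeight y v = 0 := by
  by_contra hn
  obtain ⟨t, ht, htv⟩ := exists_of_cubeWeight_ne_zero hn
  exact h (funext htv ▸ ceil_sub_mem_cubeVertices y ht)

/-- The rounding sets partition `[0, 1)`. Taking `g` constant gives total weight `1`; taking a
coordinate recovers `y`. -/
theorem sum_cubeWeight_mul (y : ι → ℝ) (g : (ι → ℤ) → ℝ) :
    ∑ v ∈ cubeVertices y, cubeWeight y v * g v =
      ∫ t in Ico (0 : ℝ) 1, g fun i => ⌈y i - t⌉ := by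
  have h1 : ∀ t ∈ Ico (0 : ℝ) 1, g (fun i => ⌈y i - t⌉) =
      ∑ v ∈ cubeVertices y, (roundingSet y v).indicator (fun _ => g v) t := by
    intro t ht
    rw [Finset.sum_eq_single_of_mem _ (ceil_sub_mem_cubeVertices y ht), indicator_of_mem]
    · exact ⟨ht, fun i => rfl⟩
    · intro v _ hv
      exact indicator_of_notMem (fun h => hv (funext h.2).symm) _
  rw [setIntegral_congr_fun measurableSet_Ico h1, integral_finsetSum]
  · refine Finset.sum_congr rfl fun v _ => ?_
    rw [setIntegral_indicator (measurableSet_roundingSet y v), setIntegral_const, smul_eq_mul,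
      inter_eq_self_of_subset_right (fun t ht => ht.1), cubeWeight]
  · intro v _
    exact ((integrable_indicator_iff (measurableSet_roundingSet y v)).2
      (integrableOn_const (volume_roundingSet_ne_top y v))).integrableOn

theorem sum_cubeWeight (y : ι → ℝ) : ∑ v ∈ cubeVertices y, cubeWeight y v = 1 := by
  simpa using sum_cubeWeight_mul y fun _ => 1

theorem setIntegral_ceil_sub (x : ℝ) : ∫ t in Ico (0 : ℝ) 1, (⌈x - t⌉ : ℝ) = x := by
  -- The integrand is `⌈x⌉` for `t < f` and `⌈x⌉ - 1` afterwards.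
  set f : ℝ := x - (⌈x⌉ - 1) with hf
  have hf0 : 0 ≤ f := by linarith [Int.ceil_lt_add_one x]
  have hf1 : f ≤ 1 := by linarith [Int.le_ceil x]
  have h1 : ∀ t ∈ Ico (0 : ℝ) 1,
      (⌈x - t⌉ : ℝ) = (⌈x⌉ - 1 : ℝ) + (Ico 0 f).indicator (fun _ => (1 : ℝ)) t := by
    intro t ht
    by_cases h : t < f
    · rw [indicator_of_mem (show t ∈ Ico 0 f from ⟨ht.1, h⟩), sub_add_cancel]
      congr 1
      rw [Int.ceil_eq_iff]
      exact ⟨by linarith, by linarith [Int.le_ceil x, ht.1]⟩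
    · rw [indicator_of_notMem (fun h' => h h'.2), add_zero]
      have : ⌈x - t⌉ = ⌈x⌉ - 1 := by
        rw [Int.ceil_eq_iff]
        push_cast
        exact ⟨by linarith [ht.2, Int.ceil_lt_add_one x], by linarith⟩
      rw [this]
      push_cast
      rfl
  rw [setIntegral_congr_fun measurableSet_Ico h1, integral_add, setIntegral_const,
    setIntegral_indicator measurableSet_Ico, setIntegral_const,
    inter_eq_self_of_subset_right (Ico_subset_Ico_right hf1)]
  · simp [Real.volume_real_Ico, max_eq_left hf0]
    linarith
  · exact integrableOn_const measure_Ico_lt_top.ne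
  · exact ((integrable_indicator_iff measurableSet_Ico).2
      (integrableOn_const measure_Ico_lt_top.ne)).integrableOn

theorem sum_cubeWeight_mul_apply (y : ι → ℝ) (i : ι) :
    ∑ v ∈ cubeVertices y, cubeWeight y v * v i = y i := by
  rw [sum_cubeWeight_mul y fun v => v i, setIntegral_ceil_sub]

/-- Uniqueness of barycentric coordinates: `x` is dominated by the weights, and both sum to `1` over
a common finite set. -/
theorem cubeWeight_sum {s : Finset (ι → ℤ)} {x : (ι → ℤ) → ℝ} (hx : ∀ v, 0 ≤ x v)
    (hs1 : ∑ v ∈ s, x v = 1) (hs0 : ∀ v ∉ s, x v = 0) (hs : ∀ v ∈ s, ∀ w ∈ s, v ≤ w ∨ w ≤ v)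
    {c : ι → ℤ} (hc : ∀ v ∈ s, c ≤ v ∧ v ≤ c + 1) (v : ι → ℤ) :
    cubeWeight (fun i => ∑ w ∈ s, x w * w i) v = x v := by
  classical
  set y : ι → ℝ := fun i => ∑ w ∈ s, x w * w i
  have hle : ∀ v, x v ≤ cubeWeight y v := by
    intro v
    by_cases hv : v ∈ s
    · exact le_cubeWeight hx hs1 hs hc hv
    · rw [hs0 v hv]
      exact cubeWeight_nonneg y v
  have h1 : ∑ v ∈ s ∪ cubeVertices y, x v = 1 := by
    rw [← hs1]
    exact (Finset.sum_subset Finset.subset_union_left fun v _ hv => hs0 v hv).symm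
  have h2 : ∑ v ∈ s ∪ cubeVertices y, cubeWeight y v = 1 := by
    rw [← sum_cubeWeight y]
    exact (Finset.sum_subset Finset.subset_union_right fun v _ hv => cubeWeight_eq_zero hv).symm
  by_cases hv : v ∈ s ∪ cubeVertices y
  · exact ((Finset.sum_eq_sum_iff_of_le fun w _ => hle w).1 (h1.trans h2.symm) v hv).symm
  · rw [Finset.mem_union, not_or] at hv
    rw [hs0 v hv.1, cubeWeight_eq_zero hv.2]

end Cubes

section Cubes

variable {ι : Type}

/-- The point of `ℝ^ι` with given barycentric coordinates. -/
noncomputable def cubeCombination (x : lp (fun _ : ULift.{u} (ι → ℤ) => ℝ) 1) (i : ι) : ℝ :=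
  ∑' v, x v * v.down i

theorem cubeCombination_eq_sum {x : lp (fun _ : ULift.{u} (ι → ℤ) => ℝ) 1}
    {s : Finset (ULift.{u} (ι → ℤ))} (hs : ∀ v ∉ s, x v = 0) (i : ι) :
    cubeCombination x i = ∑ v ∈ s, x v * v.down i :=
  tsum_eq_sum fun v hv => by rw [hs v hv, zero_mul]

theorem cubeCombination_mem {C : Set (ι → ℤ)} {x : lp (fun _ : ULift.{u} (ι → ℤ) => ℝ) 1}
    (hx : x ∈ geometricRealization (cubeComplex.{u} C)) : cubeCombination x ∈ cubeUnion C := by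
  obtain ⟨h0, s, ⟨-, -, c, hC, hc⟩, hs, hs1⟩ := hx
  refine ⟨c, hC, fun i => ?_⟩
  rw [cubeCombination_eq_sum hs]
  constructor
  · rw [← one_mul (c i : ℝ), ← hs1, Finset.sum_mul]
    refine Finset.sum_le_sum fun v hv => mul_le_mul_of_nonneg_left ?_ (h0 v)
    exact_mod_cast (hc v hv).1 i
  · have h1 : (∑ v ∈ s, x v) * (c i + 1) = c i + 1 := by rw [hs1, one_mul]
    rw [← h1, Finset.sum_mul]
    refine Finset.sum_le_sum fun v hv => mul_le_mul_of_nonneg_left ?_ (h0 v)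
    exact_mod_cast (hc v hv).2 i

variable [Fintype ι] [DecidableEq ι]

/-- The point of `ℓ¹` with barycentric coordinates `cubeWeight y`. -/
noncomputable def cubePoint (y : ι → ℝ) : lp (fun _ : ULift.{u} (ι → ℤ) => ℝ) 1 :=
  ∑ v ∈ cubeVertices y, lp.single 1 (ULift.up v) (cubeWeight y v)

theorem cubePoint_apply (y : ι → ℝ) (v : ULift.{u} (ι → ℤ)) :
    cubePoint y v = cubeWeight y v.down := by
  obtain ⟨v⟩ := v
  rw [cubePoint, lp.coeFn_sum, Finset.sum_apply]
  by_cases hv : v ∈ cubeVertices y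
  · rw [Finset.sum_eq_single_of_mem v hv, lp.single_apply_self]
    intro w _ hw
    exact lp.single_apply_ne _ _ _ (fun h => hw (ULift.up_injective h).symm)
  · rw [cubeWeight_eq_zero hv]
    refine Finset.sum_eq_zero fun w hw => lp.single_apply_ne _ _ _ fun h => hv ?_
    rwa [ULift.up_injective h]

theorem cubePoint_mem {C : Set (ι → ℤ)} {y : ι → ℝ} (hy : y ∈ cubeUnion C) :
    cubePoint.{u} y ∈ geometricRealization (cubeComplex.{u} C) := by
  classical
  obtain ⟨c, hC, hc⟩ := hy
  refine ⟨fun v => cubePoint_apply y v ▸ cubeWeight_nonneg y _,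
    ((cubeVertices y).filter (cubeWeight y · ≠ 0)).map Equiv.ulift.symm.toEmbedding,
    ⟨?_, ?_, c, hC, ?_⟩, ?_, ?_⟩
  · rw [Finset.map_nonempty]
    by_contra hn
    rw [Finset.not_nonempty_iff_eq_empty, Finset.filter_eq_empty_iff] at hn
    have := sum_cubeWeight y
    rw [Finset.sum_eq_zero fun v hv => not_not.1 (hn hv)] at this
    exact zero_ne_one this
  · intro v hv w hw
    obtain ⟨v, hv', rfl⟩ := Finset.mem_map.1 hv
    obtain ⟨w, hw', rfl⟩ := Finset.mem_map.1 hw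
    obtain ⟨t, -, hvt⟩ := exists_of_cubeWeight_ne_zero (Finset.mem_filter.1 hv').2
    obtain ⟨t', -, hwt⟩ := exists_of_cubeWeight_ne_zero (Finset.mem_filter.1 hw').2
    change v ≤ w ∨ w ≤ v
    -- Rounding up `y - t` is antitone in `t`, so the vertices that occur form a chain.
    rcases le_total t t' with h | h
    · exact Or.inr fun i => by
        rw [← hvt i, ← hwt i]
        exact Int.ceil_mono (by linarith)
    · exact Or.inl fun i => by
        rw [← hvt i, ← hwt i]
        exact Int.ceil_mono (by linarith)
  · intro v hv
    obtain ⟨v, hv', rfl⟩ := Finset.mem_map.1 hv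
    obtain ⟨t, ht, hvt⟩ := exists_of_cubeWeight_ne_zero (Finset.mem_filter.1 hv').2
    change c ≤ v ∧ v ≤ c + 1
    refine ⟨fun i => ?_, fun i => ?_⟩
    -- Strictness of `t < 1` matters here: it gives `y i - t > c i - 1`.
    · rw [← hvt i, ← Int.sub_one_lt_iff, Int.lt_ceil]
      push_cast
      linarith [(hc i).1, ht.2]
    · rw [← hvt i, Int.ceil_le]
      simp only [Pi.add_apply, Pi.one_apply]
      push_cast
      linarith [(hc i).2, ht.1]
  · intro v hv
    rw [cubePoint_apply]
    by_contra hn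
    refine hv (Finset.mem_map.2 ⟨v.down, Finset.mem_filter.2 ⟨?_, hn⟩, rfl⟩)
    by_contra h
    exact hn (cubeWeight_eq_zero h)
  · rw [Finset.sum_map, ← sum_cubeWeight y]
    exact (Finset.sum_congr rfl fun v _ => cubePoint_apply y (ULift.up v)).trans (Finset.sum_filter_ne_zero _)

theorem cubeCombination_cubePoint (y : ι → ℝ) : cubeCombination (cubePoint.{u} y) = y := by
  funext i
  rw [cubeCombination_eq_sum (s := (cubeVertices y).map Equiv.ulift.symm.toEmbedding),
    Finset.sum_map, ← sum_cubeWeight_mul_apply y i]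
  · exact Finset.sum_congr rfl fun v _ => by rw [cubePoint_apply]; rfl
  · intro v hv
    rw [cubePoint_apply]
    exact cubeWeight_eq_zero fun h => hv (Finset.mem_map.2 ⟨v.down, h, rfl⟩)

theorem cubePoint_cubeCombination {C : Set (ι → ℤ)}
    {x : lp (fun _ : ULift.{u} (ι → ℤ) => ℝ) 1}
    (hx : x ∈ geometricRealization (cubeComplex.{u} C)) : cubePoint (cubeCombination x) = x := by
  obtain ⟨h0, s, ⟨-, hch, c, hC, hc⟩, hs, hs1⟩ := hx
  ext v
  rw [cubePoint_apply]
  have hmem : ∀ w ∈ s.map Equiv.ulift.toEmbedding, ULift.up w ∈ s := by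
    intro w hw
    obtain ⟨w, hw', rfl⟩ := Finset.mem_map.1 hw
    exact hw'
  have h := cubeWeight_sum (s := s.map Equiv.ulift.toEmbedding) (x := fun w => x (ULift.up w))
    (c := c) (fun w => h0 _) (by rw [Finset.sum_map]; exact hs1)
    (fun w hw => hs _ fun h => hw (Finset.mem_map.2 ⟨_, h, rfl⟩))
    (fun w hw w' hw' => hch _ (hmem w hw) _ (hmem w' hw')) (fun w hw => hc _ (hmem w hw)) v.down
  rw [← h]
  congr 1
  funext i
  rw [cubeCombination_eq_sum hs, Finset.sum_map]
  rfl

theorem continuous_cubeCombination (C : Set (ι → ℤ)) :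
    Continuous fun x : geometricRealization (cubeComplex.{u} C) => cubeCombination x.1 := by
  refine continuous_pi fun i => continuous_iff_continuousAt.2 fun x₀ => ?_
  have hcoord := continuous_geometricRealization_iff.1
    (continuous_id (X := geometricRealization (cubeComplex.{u} C)))
  obtain ⟨h0, s, -, hs, hs1⟩ := x₀.2
  obtain ⟨v₀, hv₀, hpos⟩ : ∃ v ∈ s, x₀.1 v ≠ 0 := by
    by_contra! hn
    rw [Finset.sum_eq_zero hn] at hs1
    exact zero_ne_one hs1
  -- Near `x₀` the coordinate at `v₀` stays nonzero, so the simplex contains `v₀` and its vertices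
  -- lie within sup-distance `1` of it. The infinite sum is thus locally a sum over the fixed finite
  -- set `B`.
  let B : Finset (ULift.{u} (ι → ℤ)) :=
    (Finset.Icc (v₀.down - 1) (v₀.down + 1)).map Equiv.ulift.symm.toEmbedding
  have hev : (fun x : geometricRealization (cubeComplex.{u} C) => ∑ v ∈ B, x.1 v * v.down i)
      =ᶠ[𝓝 x₀] fun x => cubeCombination x.1 i := by
    filter_upwards [(hcoord v₀).continuousAt.eventually_ne hpos] with x hx
    obtain ⟨-, t, ⟨-, -, c, -, hc⟩, ht, -⟩ := x.2
    have hv₀t : v₀ ∈ t := by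
      by_contra h
      exact hx (ht v₀ h)
    refine (cubeCombination_eq_sum (fun v hv => ht v fun hvt => hv ?_) i).symm
    refine Finset.mem_map.2 ⟨v.down, Finset.mem_Icc.2 ⟨fun j => ?_, fun j => ?_⟩, rfl⟩
    · have h1 : v₀.down j ≤ c j + 1 := (hc v₀ hv₀t).2 j
      have h2 : c j ≤ v.down j := (hc v hvt).1 j
      change v₀.down j - 1 ≤ v.down j
      omega
    · have h1 : c j ≤ v₀.down j := (hc v₀ hv₀t).1 j
      have h2 : v.down j ≤ c j + 1 := (hc v hvt).2 j
      change v.down j ≤ v₀.down j + 1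
      omega
  refine ContinuousAt.congr ?_ hev
  exact (continuous_finsetSum _ fun v _ => (hcoord v).mul continuous_const).continuousAt

/-- The Freudenthal triangulation of a union of unit cubes. -/
noncomputable def cubeUnionHomeomorph (C : Set (ι → ℤ)) :
    cubeUnion C ≃ₜ geometricRealization (cubeComplex.{u} C) where
  toFun y := ⟨cubePoint y.1, cubePoint_mem y.2⟩
  invFun x := ⟨cubeCombination x.1, cubeCombination_mem x.2⟩
  left_inv y := Subtype.ext (cubeCombination_cubePoint y.1)
  right_inv x := Subtype.ext (cubePoint_cubeCombination x.2)
  continuous_toFun := continuous_geometricRealization_iff.2 fun v => by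
    simp only [cubePoint_apply]
    exact (continuous_cubeWeight v.down).comp continuous_subtype_val
  continuous_invFun := (continuous_cubeCombination C).subtype_mk _

theorem isClosed_cubeUnion (C : Set (ι → ℤ)) : IsClosed (cubeUnion C) := by
  -- A unit ball meets only finitely many cubes, so their union is closed.
  have hloc : LocallyFinite fun c : C => Icc (fun i => ((c : ι → ℤ) i : ℝ)) fun i => c.1 i + 1 := by
    intro y
    refine ⟨Metric.ball y 1, Metric.ball_mem_nhds y one_pos, ?_⟩
    refine Finite.of_finite_image (f := Subtype.val) ((Finset.Icc (fun i => ⌊y i⌋ - 2)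
      (fun i => ⌊y i⌋ + 2)).finite_toSet.subset ?_) Subtype.val_injective.injOn
    rintro _ ⟨c, ⟨z, hz, hzy⟩, rfl⟩
    rw [Finset.coe_Icc]
    have hd : ∀ i, |z i - y i| < 1 := fun i => (dist_le_pi_dist z y i).trans_lt hzy
    refine ⟨fun i => ?_, fun i => ?_⟩
    · have h1 : (⌊y i⌋ : ℝ) - 2 < c.1 i + 1 := by
        linarith [Int.floor_le (y i), (abs_lt.1 (hd i)).1, hz.2 i]
      have h2 : ⌊y i⌋ - 2 < c.1 i + 1 := by exact_mod_cast h1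
      exact Int.lt_add_one_iff.1 h2
    · have h1 : (c.1 i : ℝ) < ⌊y i⌋ + 2 := by
        have := hz.1 i
        simp only at this
        linarith [Int.lt_floor_add_one (y i), (abs_lt.1 (hd i)).2]
      have h2 : c.1 i < ⌊y i⌋ + 2 := by exact_mod_cast h1
      exact h2.le
  convert hloc.isClosed_iUnion fun c => isClosed_Icc
  ext y
  simp only [cubeUnion, mem_ofPred_eq, mem_iUnion, Subtype.exists, mem_Icc, Pi.le_def, exists_prop,
    forall_and]

end Cubes

theorem isLocallyCompactPolyhedron_cubeUnion {ι : Type} [Finite ι] (C : Set (ι → ℤ)) :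
    IsLocallyCompactPolyhedron (ULift.{u} (cubeUnion C)) := by
  classical
  have := Fintype.ofFinite ι
  have hlc : LocallyCompactSpace (cubeUnion C) := (isClosed_cubeUnion C).locallyCompactSpace
  refine ⟨⟨Homeomorph.ulift.isEmbedding.metrizableSpace, ?_⟩,
    Homeomorph.ulift.isClosedEmbedding.locallyCompactSpace,
    _, _, ⟨Homeomorph.ulift.trans (cubeUnionHomeomorph.{u} C)⟩⟩
  exact (Homeomorph.ulift (X := cubeUnion C)).symm.surjective.denseRange.separableSpace
    Homeomorph.ulift.symm.continuous

/-! ### Closed subsets of `ℝ^ℕ` as inverse limits of polyhedra -/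

section ClosedSubsets

variable (S : Set (ℕ → ℝ))

/-- The lowest corners of the unit cubes of `ℝⁿ` that meet the projection of `2ⁿ S`. -/
def cubesMeeting (n : ℕ) : Set (Fin n → ℤ) :=
  {c | ∃ x ∈ S, ∀ i, (c i : ℝ) ≤ 2 ^ n * x i ∧ 2 ^ n * x i ≤ c i + 1}

theorem two_pow_mul_mem_cubeUnion {x : ℕ → ℝ} (hx : x ∈ S) (n : ℕ) :
    (fun i : Fin n => 2 ^ n * x i) ∈ cubeUnion (cubesMeeting S n) := by
  have h : ∀ i : Fin n, ((⌊2 ^ n * x i⌋ : ℤ) : ℝ) ≤ 2 ^ n * x i ∧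
      2 ^ n * x i ≤ (⌊2 ^ n * x i⌋ : ℤ) + 1 :=
    fun i => ⟨Int.floor_le _, (Int.lt_floor_add_one _).le⟩
  exact ⟨_, ⟨x, hx, h⟩, h⟩

/-- Passing down a level forgets the last coordinate and halves the scale. Integer division rounds
down, so `c / 2` is the corner of the unit cube containing the halved cube, and the same `x`
witnesses that it meets the set. -/
theorem half_mem_cubeUnion {n : ℕ} {z : Fin (n + 1) → ℝ}
    (hz : z ∈ cubeUnion (cubesMeeting S (n + 1))) :
    (fun i : Fin n => z i.castSucc / 2) ∈ cubeUnion (cubesMeeting S n) := by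
  obtain ⟨c, ⟨x, hx, hcx⟩, hc⟩ := hz
  have h1 : ∀ i : Fin n, 2 * ((c i.castSucc / 2 : ℤ) : ℝ) ≤ c i.castSucc := by
    intro i
    exact_mod_cast Int.mul_ediv_self_le two_ne_zero
  have h2 : ∀ i : Fin n, (c i.castSucc : ℝ) + 1 ≤ 2 * ((c i.castSucc / 2 : ℤ) : ℝ) + 2 := by
    intro i
    have : c i.castSucc + 1 ≤ 2 * (c i.castSucc / 2) + 2 := by omega
    exact_mod_cast this
  refine ⟨fun i => c i.castSucc / 2, ⟨x, hx, fun i => ?_⟩, fun i => ?_⟩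
  · have h3 := hcx i.castSucc
    rw [Fin.val_castSucc, pow_succ] at h3
    constructor <;> linarith [h1 i, h2 i, h3.1, h3.2]
  · constructor <;> linarith [h1 i, h2 i, (hc i.castSucc).1, (hc i.castSucc).2]

/-- The bonding maps of the inverse sequence of cubical neighbourhoods of a subset of `ℝ^ℕ`. -/
noncomputable def cubicalBonding (n : ℕ) (z : ULift.{u} (cubeUnion (cubesMeeting S (n + 1)))) :
    ULift.{u} (cubeUnion (cubesMeeting S n)) :=
  ⟨fun i => z.down.1 i.castSucc / 2, half_mem_cubeUnion S z.down.2⟩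

theorem continuous_cubicalBonding (n : ℕ) : Continuous (cubicalBonding.{u} S n) := by
  refine continuous_uliftUp.comp (Continuous.subtype_mk ?_ _)
  refine continuous_pi fun i => ?_
  exact ((continuous_apply _).comp (continuous_subtype_val.comp continuous_uliftDown)).div_const 2

/-- The point of `ℝ^ℕ` given by a thread of the inverse sequence of cubical neighbourhoods. -/
noncomputable def cubicalLimitPoint
    (z : ∀ n, ULift.{u} (cubeUnion (cubesMeeting S n))) (i : ℕ) : ℝ :=
  (z (i + 1)).down.1 (Fin.last i) / 2 ^ (i + 1)

variable {S}

theorem thread_apply {z : ∀ n, ULift.{u} (cubeUnion (cubesMeeting S n))}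
    (hz : z ∈ inverseLimit (cubicalBonding S)) (n : ℕ) (i : Fin n) :
    (z n).down.1 i = 2 ^ n * cubicalLimitPoint S z i := by
  induction n with
  | zero => exact i.elim0
  | succ n ih =>
    induction i using Fin.lastCases with
    | last =>
      rw [cubicalLimitPoint, Fin.val_last, mul_div_cancel₀]
      positivity
    | cast i =>
      have h1 : (z (n + 1)).down.1 i.castSucc / 2 = (z n).down.1 i := by
        rw [← hz n]
        rfl
      rw [Fin.val_castSucc, pow_succ, mul_right_comm, ← ih i, ← h1, div_mul_cancel₀ _ two_ne_zero]

theorem cubicalLimitPoint_mem (hS : IsClosed S)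
    {z : ∀ n, ULift.{u} (cubeUnion (cubesMeeting S n))}
    (hz : z ∈ inverseLimit (cubicalBonding S)) : cubicalLimitPoint S z ∈ S := by
  -- At level `n` the limit point and some point `x n` of `S` share a cube, so their first `n`
  -- coordinates differ by at most `2⁻ⁿ`.
  choose c hc hcz using fun n => (z n).down.2
  choose x hxS hcx using hc
  refine hS.mem_of_tendsto (b := atTop) (f := x) ?_ (Eventually.of_forall hxS)
  refine tendsto_pi_nhds.2 fun i => tendsto_iff_dist_tendsto_zero.2 ?_
  have hlim : Tendsto (fun n : ℕ => (1 / 2 : ℝ) ^ n) atTop (𝓝 0) :=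
    tendsto_pow_atTop_nhds_zero_of_lt_one (by norm_num) (by norm_num)
  refine squeeze_zero' (Eventually.of_forall fun n => dist_nonneg) ?_ hlim
  filter_upwards [eventually_gt_atTop i] with n hn
  have h1 := hcx n ⟨i, hn⟩
  have h2 := hcz n ⟨i, hn⟩
  rw [thread_apply hz] at h2
  have hpos : (0 : ℝ) < 2 ^ n := by positivity
  rw [one_div, inv_pow, ← mul_le_mul_iff_right₀ hpos, mul_inv_cancel₀ hpos.ne', Real.dist_eq,
    ← abs_of_pos (a := (2 : ℝ) ^ n) hpos, ← abs_mul, mul_sub, abs_le]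
  constructor <;> linarith [h1.1, h1.2, h2.1, h2.2]

/-- A closed subset of `ℝ^ℕ` is the limit of its cubical neighbourhoods. -/
noncomputable def homeomorphInverseLimit (hS : IsClosed S) :
    S ≃ₜ inverseLimit (Y := fun n => ULift.{u} (cubeUnion (cubesMeeting S n)))
      (cubicalBonding.{u} S) where
  toFun x := ⟨fun n => ⟨fun i => 2 ^ n * x.1 i, two_pow_mul_mem_cubeUnion S x.2 n⟩, fun n => by
    refine ULift.ext _ _ (Subtype.ext (funext fun i => ?_))
    simp only [cubicalBonding, Fin.val_castSucc, pow_succ]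
    ring⟩
  invFun z := ⟨cubicalLimitPoint S z.1, cubicalLimitPoint_mem hS z.2⟩
  left_inv x := Subtype.ext (funext fun i => by simp [cubicalLimitPoint])
  right_inv z := Subtype.ext (funext fun n => ULift.ext _ _ (Subtype.ext (funext fun i =>
    (thread_apply z.2 n i).symm)))
  continuous_toFun := by
    refine Continuous.subtype_mk (continuous_pi fun n => continuous_uliftUp.comp
      (Continuous.subtype_mk (continuous_pi fun i => ?_) _)) _
    exact continuous_const.mul ((continuous_apply _).comp continuous_subtype_val)
  continuous_invFun := by
    refine Continuous.subtype_mk (continuous_pi fun i => Continuous.div_const ?_ _) _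
    exact (continuous_apply _).comp (continuous_subtype_val.comp
      (continuous_uliftDown.comp ((continuous_apply _).comp continuous_subtype_val)))

end ClosedSubsets

theorem varPi_one_of_isClosedEmbedding {A : Type u} [TopologicalSpace A] {e : A → ℕ → ℝ}
    (he : IsClosedEmbedding e) : varPi 1 A :=
  ⟨fun n => ULift.{u} (cubeUnion (cubesMeeting (range e) n)), fun _ => inferInstance,
    cubicalBonding.{u} (range e), fun _ => isLocallyCompactPolyhedron_cubeUnion _,
    continuous_cubicalBonding _,
    ⟨he.toHomeomorph.trans (homeomorphInverseLimit he.isClosed_range)⟩⟩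

/-! ### `G_δ` subsets of compacta -/

theorem isClosedEmbedding_inv_infDist {H : Type*} [MetricSpace H] {U : ℕ → Set H}
    (hU : ∀ i, IsOpen (U i)) :
    IsClosedEmbedding fun x : ⋂ i, U i =>
      ((x : H), fun i => (Metric.infDist (x : H) (U i)ᶜ)⁻¹) := by
  have hpos : ∀ i, U i ≠ univ → ∀ x, x ∈ U i ↔ Metric.infDist x (U i)ᶜ ≠ 0 := by
    intro i hi x
    have := (hU i).isClosed_compl.mem_iff_infDist_zero (nonempty_compl.2 hi) (x := x)
    rw [Ne, ← this, mem_compl_iff, not_not]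
  have hcont : Continuous fun x : ⋂ i, U i =>
      ((x : H), fun i => (Metric.infDist (x : H) (U i)ᶜ)⁻¹) := by
    refine continuous_subtype_val.prodMk (continuous_pi fun i => ?_)
    by_cases hi : U i = univ
    · simp only [hi, compl_univ, Metric.infDist_empty]
      exact continuous_const
    · exact ((Metric.continuous_infDist_pt _).comp continuous_subtype_val).inv₀
        fun x => (hpos i hi x).1 (mem_iInter.1 x.2 i)
  refine ⟨IsEmbedding.of_comp hcont continuous_fst IsEmbedding.subtypeVal, ?_⟩
  -- The equation `r * infDist = 1` is closed and forces the point into `U i`. If `U i` is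
  -- everything, the distance to the empty set is `0` by convention, and so is its inverse.
  have : range (fun x : ⋂ i, U i => ((x : H), fun i => (Metric.infDist (x : H) (U i)ᶜ)⁻¹)) =
      ⋂ i, {p : H × (ℕ → ℝ) | (U i = univ → p.2 i = 0) ∧
        (U i ≠ univ → p.2 i * Metric.infDist p.1 (U i)ᶜ = 1)} := by
    ext ⟨x, r⟩
    simp only [mem_range, mem_iInter, mem_ofPred_eq, Prod.mk.injEq]
    constructor
    · rintro ⟨x, rfl, rfl⟩ i
      refine ⟨fun hi => by simp [hi], fun hi => inv_mul_cancel₀ ?_⟩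
      exact (hpos i hi x).1 (mem_iInter.1 x.2 i)
    · intro h
      refine ⟨⟨x, mem_iInter.2 fun i => ?_⟩, rfl, funext fun i => ?_⟩
      · by_cases hi : U i = univ
        · rw [hi]
          trivial
        · exact (hpos i hi x).2 (right_ne_zero_of_mul_eq_one ((h i).2 hi))
      · by_cases hi : U i = univ
        · rw [(h i).1 hi]
          simp [hi]
        · exact (eq_inv_of_mul_eq_one_left ((h i).2 hi)).symm
  rw [this]
  refine isClosed_iInter fun i => ?_
  by_cases hi : U i = univ
  · simp only [hi, ne_eq, not_true_eq_false, true_imp_iff, false_imp_iff, and_true]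
    exact isClosed_eq ((continuous_apply i).comp continuous_snd) continuous_const
  · simp only [hi, ne_eq, not_false_eq_true, true_imp_iff, false_imp_iff, true_and]
    exact isClosed_eq (((continuous_apply i).comp continuous_snd).mul
      ((Metric.continuous_infDist_pt _).comp continuous_fst)) continuous_const

theorem varPi_one_of_isGδ {H : Type u} [TopologicalSpace H] [CompactSpace H] [MetrizableSpace H]
    {s : Set H} (hs : IsGδ s) : varPi 1 s := by
  let := metrizableSpaceMetric H
  obtain ⟨U, hU, rfl⟩ := isGδ_iff_eq_iInter_nat.1 hs
  obtain ⟨h, hh⟩ := Metric.PiNatEmbed.exists_embedding_to_hilbert_cube (X := H)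
  have h1 : IsClosedEmbedding h := hh.continuous.isClosedEmbedding hh.injective
  have h2 : IsClosedEmbedding fun (x : ℕ → unitInterval) (i : ℕ) => (x i : ℝ) :=
    (continuous_pi fun i => continuous_subtype_val.comp (continuous_apply i)).isClosedEmbedding
      fun x y hxy => funext fun i => Subtype.ext (congrFun hxy i)
  -- Two sequences of coordinates are merged into one.
  let Φ : (ℕ → ℝ) × (ℕ → ℝ) ≃ₜ (ℕ → ℝ) :=
    Homeomorph.sumArrowHomeomorphProdArrow.symm.trans
      (Homeomorph.piCongrLeft (Y := fun _ : ℕ => ℝ) Equiv.natSumNatEquivNat)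
  exact varPi_one_of_isClosedEmbedding (Φ.isClosedEmbedding.comp
    (((h2.comp h1).prodMap .id).comp (isClosedEmbedding_inv_infDist hU)))

/-! ### Embeddings in the Hilbert cube -/

/-- The Hilbert cube. -/
abbrev HilbertCube : Type u := ULift.{u} (ℕ → unitInterval)

instance : MetrizableSpace HilbertCube.{u} := Homeomorph.ulift.isEmbedding.metrizableSpace

instance : SecondCountableTopology HilbertCube.{u} :=
  Homeomorph.ulift.secondCountableTopology

theorem IsSepMetrizable.exists_isEmbedding {X : Type u} [TopologicalSpace X]
    (hX : IsSepMetrizable X) : ∃ e : X → HilbertCube.{u}, IsEmbedding e := by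
  have := hX.1
  have := hX.2
  let := metrizableSpaceMetric X
  obtain ⟨e, he⟩ := Metric.PiNatEmbed.exists_embedding_to_hilbert_cube (X := X)
  exact ⟨_, Homeomorph.ulift.symm.isEmbedding.comp he⟩

theorem IsSepMetrizable.secondCountableTopology {X : Type u} [TopologicalSpace X]
    (hX : IsSepMetrizable X) : SecondCountableTopology X := by
  have := hX.1
  have := hX.2
  let := metrizableSpaceMetric X
  exact UniformSpace.secondCountable_of_separable X

theorem isSepMetrizable_of_isEmbedding {A : Type u} {X : Type*} [TopologicalSpace A]
    [TopologicalSpace X] [MetrizableSpace X] [SecondCountableTopology X] {e : A → X}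
    (he : IsEmbedding e) : IsSepMetrizable A := by
  have := he.secondCountableTopology
  exact ⟨he.metrizableSpace, inferInstance⟩

theorem isSepMetrizable_of_varSigma {n : ℕ} {X : Type u} [TopologicalSpace X]
    (hX : varSigma n X) : IsSepMetrizable X := by
  cases n with
  | zero => exact hX.1
  | succ n => exact hX.1

theorem varPi_of_homeomorph {n : ℕ} {X Y : Type u} [TopologicalSpace X] [TopologicalSpace Y]
    (e : X ≃ₜ Y) (hX : varPi n X) : varPi n Y := by
  cases n with
  | zero =>
    have := hX.1
    have := hX.2
    exact ⟨e.compactSpace, e.symm.isEmbedding.metrizableSpace⟩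
  | succ n =>
    obtain ⟨Z, _, f, hZ, hf, ⟨g⟩⟩ := hX
    exact ⟨Z, _, f, hZ, hf, ⟨e.symm.trans g⟩⟩

/-! ### Borel subsets of compacta belong to the inductive classes -/

section FromBorel

variable {H : Type u} [TopologicalSpace H] [CompactSpace H] [MetrizableSpace H]

theorem varSigma_succ_of_borelSigma {n : ℕ} (h : ∀ s ∈ borelPi n H, varPi n s) {X : Type u}
    [TopologicalSpace X] {e : X → H} (he : IsEmbedding e)
    (hr : range e ∈ borelSigma (n + 1) H) : varSigma (n + 1) X := by
  let := metrizableSpaceMetric H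
  obtain ⟨t, ht, hrt⟩ := hr
  refine ⟨isSepMetrizable_of_isEmbedding he, fun i => e ⁻¹' t i, fun i => ?_, ?_⟩
  · have hi : IsEmbedding fun x : e ⁻¹' t i => e x := he.comp IsEmbedding.subtypeVal
    have hrange : range (fun x : e ⁻¹' t i => e x) = t i := by
      apply Subset.antisymm
      · rintro _ ⟨x, rfl⟩
        exact x.2
      · intro y hy
        obtain ⟨x, rfl⟩ : y ∈ range e := hrt ▸ mem_iUnion.2 ⟨i, hy⟩
        exact ⟨⟨x, hy⟩, rfl⟩
    exact varPi_of_homeomorph (hi.toHomeomorph.trans (Homeomorph.setCongr hrange)).symm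
      (h _ (ht i))
  · rw [← preimage_iUnion, ← hrt, preimage_range]

/-- A thread of inclusions is constant as a sequence in `X`, so it is a single point of the
intersection. -/
theorem InverseLimitOf.iInter {P : SpaceClass.{u}} {X : Type u} [TopologicalSpace X]
    {s : ℕ → Set X} (hs : ∀ i, s (i + 1) ⊆ s i) (h : ∀ i, P (s i)) :
    InverseLimitOf P (⋂ i, s i : Set X) := by
  refine ⟨fun i => s i, fun _ => inferInstance, fun i => inclusion (hs i), h,
    fun i => continuous_inclusion (hs i), ⟨?_⟩⟩
  have heq : ∀ z : inverseLimit (Y := fun i => s i) (fun i => inclusion (hs i)), ∀ i,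
      (z.1 i : X) = z.1 0 := by
    intro z i
    induction i with
    | zero => rfl
    | succ i ih =>
      rw [← ih, ← z.2 i]
  exact {
    toFun := fun x => ⟨fun i => ⟨x, mem_iInter.1 x.2 i⟩, fun i => rfl⟩
    invFun := fun z => ⟨z.1 0, mem_iInter.2 fun i => heq z i ▸ (z.1 i).2⟩
    left_inv := fun x => rfl
    right_inv := fun z => Subtype.ext (funext fun i => Subtype.ext (heq z i).symm)
    continuous_toFun := by fun_prop
    continuous_invFun := Continuous.subtype_mk (continuous_subtype_val.comp
      ((continuous_apply 0).comp continuous_subtype_val)) _ }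

theorem varPi_of_borelPi (n : ℕ) : ∀ s ∈ borelPi n H, varPi n s := by
  induction n using Nat.strong_induction_on with
  | _ n ih =>
    intro s hs
    match n, ih, hs with
    | 0, _, hs => exact ⟨isCompact_iff_compactSpace.1 (IsClosed.isCompact hs), inferInstance⟩
    | 1, _, ⟨s, hs, h⟩ => exact h ▸ varPi_one_of_isGδ (IsGδ.iInter_of_isOpen hs)
    | n + 2, ih, ⟨s, hs, h⟩ =>
      -- Partial intersections make the sequence decreasing; they stay in `Σ_{n+1}` by closure under
      -- finite intersections.
      let t : ℕ → Set H := fun i => {x | ∀ j ≤ i, x ∈ s j}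
      have ht : ∀ i, t i ∈ borelSigma (n + 1) H := by
        intro i
        induction i with
        | zero =>
          have h0 : t 0 = s 0 := by
            ext x
            simp [t]
          exact h0 ▸ hs 0
        | succ i iht =>
          have hi : t (i + 1) = t i ∩ s (i + 1) := by
            ext x
            simp [t, Nat.le_succ_iff, or_imp, forall_and]
          exact hi ▸ borelSigma_inter iht (hs (i + 1))
      have hst : ⋂ i, s i = ⋂ i, t i := by
        ext x
        simp only [t, mem_iInter, mem_ofPred_eq]
        exact ⟨fun h i j _ => h j, fun h i => h i i le_rfl⟩
      rw [h, hst]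
      refine InverseLimitOf.iInter (fun i x hx j hj => hx j (hj.trans i.le_succ)) fun i => ?_
      exact varSigma_succ_of_borelSigma (ih n (by omega)) IsEmbedding.subtypeVal
        (Subtype.range_coe.symm ▸ ht i)

end FromBorel

/-! ### The inductive classes are absolute -/

theorem isGδ_range_of_locallyCompactSpace {Y H : Type*} [TopologicalSpace Y]
    [LocallyCompactSpace Y] [TopologicalSpace H] [MetrizableSpace H] {k : Y → H}
    (hk : IsEmbedding k) : IsGδ (range k) := by
  let := metrizableSpaceMetric H
  -- The image is open in its closure: where `U` meets the image inside the closed set `k '' K`, no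
  -- new limit points appear in `U`.
  have : range k = closure (range k) ∩ ⋃₀ {U | IsOpen U ∧ ∃ K, IsCompact K ∧ k ⁻¹' U ⊆ K} := by
    apply Subset.antisymm
    · rintro _ ⟨y, rfl⟩
      refine ⟨subset_closure (mem_range_self y), ?_⟩
      obtain ⟨K, hK, hyK⟩ := exists_compact_mem_nhds y
      rw [hk.nhds_eq_comap, mem_comap] at hyK
      obtain ⟨V, hV, hVK⟩ := hyK
      obtain ⟨U, hUV, hU, hyU⟩ := mem_nhds_iff.1 hV
      exact ⟨U, ⟨hU, K, hK, (preimage_mono hUV).trans hVK⟩, hyU⟩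
    · rintro z ⟨hz, U, ⟨hU, K, hK, hUK⟩, hzU⟩
      have h1 : z ∈ closure (U ∩ range k) := hU.inter_closure ⟨hzU, hz⟩
      have h2 : U ∩ range k ⊆ k '' K := by
        rintro _ ⟨hyU, y, rfl⟩
        exact mem_image_of_mem k (hUK hyU)
      exact image_subset_range k K
        (closure_minimal h2 (hK.image hk.continuous).isClosed h1)
  rw [this]
  exact isClosed_closure.isGδ.inter (isOpen_sUnion fun U hU => hU.1).isGδ

theorem isClosed_inverseLimit {Y : ℕ → Type u} [∀ i, TopologicalSpace (Y i)] [∀ i, T2Space (Y i)]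
    {f : ∀ i, Y (i + 1) → Y i} (hf : ∀ i, Continuous (f i)) : IsClosed (inverseLimit f) := by
  have : inverseLimit f = ⋂ i, {y | f i (y (i + 1)) = y i} := by
    ext y
    simp [inverseLimit]
  rw [this]
  exact isClosed_iInter fun i =>
    isClosed_eq ((hf i).comp (continuous_apply (i + 1))) (continuous_apply i)

theorem absolutePi_zero_of_varPi {X : Type u} [TopologicalSpace X] (hX : varPi 0 X) :
    AbsolutePi 0 X := by
  have := hX.1
  have := hX.2
  let := metrizableSpaceMetric X
  refine ⟨⟨inferInstance, inferInstance⟩, fun Z _ hZ e he => ?_⟩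
  have := hZ.1
  exact (isCompact_range he.continuous).isClosed

theorem absoluteSigma_succ_of_varSigma {n : ℕ}
    (ih : ∀ (X : Type u) [TopologicalSpace X], varPi n X → AbsolutePi n X)
    {X : Type u} [TopologicalSpace X] (hX : varSigma (n + 1) X) : AbsoluteSigma (n + 1) X := by
  obtain ⟨hm, S, hS, hSu⟩ := hX
  refine ⟨hm, fun Z _ hZ e he => ⟨fun i => range fun x : S i => e x, fun i => ?_, ?_⟩⟩
  · exact (ih _ (hS i)).2 Z hZ _ (he.comp IsEmbedding.subtypeVal)
  · rw [← image_univ, ← hSu, image_iUnion]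
    exact iUnion_congr fun i => by rw [image_eq_range]

/-- The limit is closed in the product of the `Y i`, so in `H^ℕ` it is a closed set intersected with
the cylinders over the images of the `Y i`. The hypothesis `ih` asks only for `Π_{n+1}` in `H`, so
that it also covers locally compact polyhedra, which are `G_δ` but need not be open. -/
theorem absolutePi_succ_of_varPi {n : ℕ}
    (ih : ∀ (Y : Type u) [TopologicalSpace Y], varSigma n Y → ∀ k : Y → HilbertCube.{u},
      IsEmbedding k → range k ∈ borelPi (n + 1) HilbertCube.{u})
    {X : Type u} [TopologicalSpace X] (hX : varPi (n + 1) X) : AbsolutePi (n + 1) X := by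
  obtain ⟨Y, _, f, hY, hf, ⟨g⟩⟩ := hX
  have hYm : ∀ i, IsSepMetrizable (Y i) := fun i => isSepMetrizable_of_varSigma (hY i)
  have : ∀ i, MetrizableSpace (Y i) := fun i => (hYm i).1
  have : ∀ i, SecondCountableTopology (Y i) := fun i => (hYm i).secondCountableTopology
  have hg : IsEmbedding fun x => (g x).1 := IsEmbedding.subtypeVal.comp g.isEmbedding
  refine ⟨isSepMetrizable_of_isEmbedding hg, fun Z _ hZ e he => ?_⟩
  have := hZ.1
  choose k hk using fun i => (hYm i).exists_isEmbedding
  have hK : IsEmbedding (Pi.map k) := .piMap hk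
  have : IsCompletelyMetrizableSpace HilbertCube.{u} := by
    let := metrizableSpaceMetric HilbertCube.{u}
    infer_instance
  refine range_mem_borelPi_succ (W := ℕ → HilbertCube.{u}) he (hK.comp hg) ?_
  obtain ⟨C, hC, hCY⟩ := hK.isInducing.isClosed_iff.1 (isClosed_inverseLimit hf)
  have : range (Pi.map k ∘ fun x => (g x).1) =
      (⋂ i, (fun z : ℕ → HilbertCube.{u} => z i) ⁻¹' range (k i)) ∩ C := by
    apply Subset.antisymm
    · rintro _ ⟨x, rfl⟩
      refine ⟨mem_iInter.2 fun i => ⟨_, rfl⟩, ?_⟩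
      exact hCY.ge (g x).2
    · rintro z ⟨hz, hzC⟩
      choose y hy using mem_iInter.1 hz
      obtain rfl : Pi.map k y = z := funext hy
      have hy' : y ∈ inverseLimit f := hCY ▸ hzC
      exact ⟨g.symm ⟨y, hy'⟩, by simp⟩
  rw [this]
  refine borelPi_inter (borelPi_succ_iInter fun i => ?_)
    (borelPi_mono (Nat.zero_le _) (show C ∈ borelPi 0 _ from hC))
  exact borelPi_preimage (continuous_apply i) (ih _ (hY i) (k i) (hk i))

theorem absolutePi_of_varPi (n : ℕ) :
    ∀ (X : Type u) [TopologicalSpace X], varPi n X → AbsolutePi n X := by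
  induction n using Nat.strong_induction_on with
  | _ n ih =>
    intro X _ hX
    match n, ih, hX with
    | 0, _, hX => exact absolutePi_zero_of_varPi hX
    | 1, _, hX =>
      refine absolutePi_succ_of_varPi (fun Y _ hY k hk => ?_) hX
      have := hY.2.1
      exact isGδ_mem_borelPi_succ (isGδ_range_of_locallyCompactSpace hk) 0
    | n + 2, ih, hX =>
      refine absolutePi_succ_of_varPi (fun Y _ hY k hk => ?_) hX
      exact borelSigma_subset_borelPi_succ _ ((absoluteSigma_succ_of_varSigma
        (ih n (by omega)) hY).2 _ ⟨inferInstance, inferInstance⟩ k hk)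

theorem varPi_of_absolutePi {n : ℕ} {X : Type u} [TopologicalSpace X] (hX : AbsolutePi n X) :
    varPi n X := by
  obtain ⟨e, he⟩ := hX.1.exists_isEmbedding
  exact varPi_of_homeomorph he.toHomeomorph.symm
    (varPi_of_borelPi n _ (hX.2 _ ⟨inferInstance, inferInstance⟩ e he))

theorem varSigma_of_absoluteSigma {n : ℕ} {X : Type u} [TopologicalSpace X]
    (hX : AbsoluteSigma (n + 1) X) : varSigma (n + 1) X := by
  obtain ⟨e, he⟩ := hX.1.exists_isEmbedding
  exact varSigma_succ_of_borelSigma (varPi_of_borelPi n) he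
    (hX.2 _ ⟨inferInstance, inferInstance⟩ e he)

end DescriptiveTopology

theorem mainTheorem12 :
    (∀ (n : ℕ) (X : Type u) [TopologicalSpace X],
      DescriptiveTopology.varPi n X ↔ DescriptiveTopology.AbsolutePi n X) ∧
    (∀ (n : ℕ), 1 ≤ n → ∀ (X : Type u) [TopologicalSpace X],
      DescriptiveTopology.varSigma n X ↔ DescriptiveTopology.AbsoluteSigma n X) := by
  refine ⟨fun n X _ => ⟨DescriptiveTopology.absolutePi_of_varPi n X,
    DescriptiveTopology.varPi_of_absolutePi⟩, fun n hn X _ => ?_⟩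
  obtain ⟨n, rfl⟩ := Nat.exists_eq_add_of_le' hn
  exact ⟨DescriptiveTopology.absoluteSigma_succ_of_varSigma
    (DescriptiveTopology.absolutePi_of_varPi n),
    DescriptiveTopology.varSigma_of_absoluteSigma⟩
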